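/- Consider the Dai–Hasenbein–Vande Vate (DHV) network: three stations and six job classes; jobs arrive from outside only to class 1, at rate $\alpha_1\ge 0$, visit the classes $1\to2\to3\to4\to5\to6$ in this order and then leave; station 1 serves classes 1 and 4, station 2 serves classes 2 and 5, station 3 serves classes 3 and 6; class $k$ has mean service time $m_k>0$. Let $C$ be the $3\times 6$ constituency matrix ($C_{jk}=1$ if class $k$ is served at station $j$, and $0$ otherwise), $M=\mathrm{diag}(m_1,\dots,m_6)$, $P$ the routing matrix, $Q=(I-P')^{-1}$, $\alpha=(\alpha_1,0,0,0,0,0)'$, $\rho=CMQ\alpha$ the vector of traffic intensities, and $e=(1,1,1)'$. A ratio matrix is a nonnegative $6\times 3$ matrix $\Delta$ with $\Delta_{kj}=0$ whenever class $k$ is not served at station $j$, and with $CM\Delta=I$. Suppose that the network is balanced, that is, $m_1+m_4=m_2+m_5=m_3+m_6$, and that it satisfies the nominal-load conditions $\rho_j<1$ for $j=1,2,3$. (If the common value of the three sums is normalized to $1$, these conditions say that $\alpha_1<1$.) Then for every ratio matrix $\Delta$ the matrix $CMQ\Delta$ is invertible and, with $R=(CMQ\Delta)^{-1}$ and $\theta=R(\rho-e)$,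 the Skorohod problem with data $(R,\theta)$ is stable, in the following sense: whenever $Y,W:[0,\infty)\to\mathbb{R}^3$ are continuous, $W(t)\ge 0$ and $W(t)=W(0)+\theta t+RY(t)$ for all $t\ge0$, $Y(0)=0$, each $Y_j$ is nondecreasing, and $\int_0^\infty W_j(t)\,dY_j(t)=0$ for $j=1,2,3$, there is a $T\in[0,\infty)$ (which may depend on $(Y,W)$) such that $W(t)=0$ for all $t\ge T$. -/

import Mathlib

open scoped NNReal ENNReal

/-- The primitives `(C, M, P, α)` of an open multiclass queueing network, with stations `J` and
classes `K`: `station k` is the station serving class `k`, `m k` is the mean service time of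
class `k`, `P k l` is the probability that a class-`k` job turns into a class-`l` job after
service, and `α k` is the rate of exogenous arrivals to class `k`. -/
structure MulticlassNetwork (J K : Type*) [Fintype J] [DecidableEq J]
    [Fintype K] [DecidableEq K] where
  station : K → J
  m : K → ℝ
  m_pos : ∀ k, 0 < m k
  P : Matrix K K ℝ
  P_nonneg : ∀ k l, 0 ≤ P k l
  P_row_sum_le_one : ∀ k, ∑ l, P k l ≤ 1
  summable_pow_P : Summable (fun n : ℕ => P ^ n)
  isUnit_one_sub_transpose_P : IsUnit (1 - P.transpose)
  α : K → ℝ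
  α_nonneg : ∀ k, 0 ≤ α k

namespace MulticlassNetwork

variable {J K : Type*} [Fintype J] [DecidableEq J] [Fintype K] [DecidableEq K]

/-- The constituency matrix `C`. -/
def C (N : MulticlassNetwork J K) : Matrix J K ℝ :=
  Matrix.of fun j k => if N.station k = j then 1 else 0

/-- The diagonal matrix `M` of mean service times. -/
def M (N : MulticlassNetwork J K) : Matrix K K ℝ :=
  Matrix.diagonal N.m

/-- `Q = (I - P')⁻¹`; `Q k l` is the expected number of visits to class `k` from class `l`. -/
noncomputable def Q (N : MulticlassNetwork J K) : Matrix K K ℝ :=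
  (1 - N.P.transpose)⁻¹

/-- The effective arrival rates `λ = Q α`. -/
noncomputable def effectiveRate (N : MulticlassNetwork J K) : K → ℝ :=
  N.Q.mulVec N.α

/-- The traffic intensities `ρ = C M λ`. -/
noncomputable def ρ (N : MulticlassNetwork J K) : J → ℝ :=
  (N.C * N.M).mulVec N.effectiveRate

/-- The nominal-load conditions: `ρ j < 1` at every station. -/
def NominalLoad (N : MulticlassNetwork J K) : Prop :=
  ∀ j, N.ρ j < 1

/-- Ratio matrices: nonnegative `K × J` matrices `Δ` with `Δ k j = 0` unless class `k` is
served at station `j`, and with `C M Δ = I`. -/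
structure IsRatioMatrix (N : MulticlassNetwork J K) (Δ : Matrix K J ℝ) : Prop where
  nonneg : ∀ k j, 0 ≤ Δ k j
  eq_zero_of_station_ne : ∀ k j, N.station k ≠ j → Δ k j = 0
  workload : N.C * N.M * Δ = 1

/-- The matrix `C M Q Δ`, whose inverse is the reflection matrix. -/
noncomputable def invReflection (N : MulticlassNetwork J K) (Δ : Matrix K J ℝ) : Matrix J J ℝ :=
  N.C * N.M * N.Q * Δ

/-- The reflection matrix `R = (C M Q Δ)⁻¹` (meaningful when `C M Q Δ` is invertible). -/
noncomputable def R (N : MulticlassNetwork J K) (Δ : Matrix K J ℝ) : Matrix J J ℝ :=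
  (N.invReflection Δ)⁻¹

/-- The drift `θ = R (ρ - e)`. -/
noncomputable def θ (N : MulticlassNetwork J K) (Δ : Matrix K J ℝ) : J → ℝ :=
  (N.R Δ).mulVec (N.ρ - 1)

end MulticlassNetwork

/-- `(Y, W)` solves the linear Skorohod problem with reflection matrix `R` and drift `θ`: both
are continuous on `[0, ∞)`, `W` takes values in the nonnegative orthant,
`W t = W 0 + θ t + R Y t`, `Y` starts at `0` and is nondecreasing, and
`∫₀^∞ W_j dY_j = 0` (a Lebesgue-Stieltjes integral) for every `j`. -/
structure SolvesSkorohod {J : Type*} [Fintype J] (R : Matrix J J ℝ) (θ : J → ℝ)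
    (Y W : ℝ≥0 → J → ℝ) : Prop where
  continuous_Y : ∀ j, Continuous fun t => Y t j
  continuous_W : ∀ j, Continuous fun t => W t j
  W_nonneg : ∀ t j, 0 ≤ W t j
  W_eq : ∀ t, W t = W 0 + (t : ℝ) • θ + R.mulVec (Y t)
  Y_zero : Y 0 = 0
  monotone_Y : ∀ j, Monotone fun t => Y t j
  complementarity : ∀ j, ∫⁻ t, ENNReal.ofReal (W t j)
    ∂(StieltjesFunction.mk (fun t => Y t j) (monotone_Y j)
      (fun _ => (continuous_Y j).continuousWithinAt)).measure = 0

/-- The Skorohod problem is stable: every solution, from any initial state, has `W` equal to `0`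
from some finite time onward. -/
def SkorohodStable {J : Type*} [Fintype J] (R : Matrix J J ℝ) (θ : J → ℝ) : Prop :=
  ∀ Y W : ℝ≥0 → J → ℝ, SolvesSkorohod R θ Y W → ∃ T : ℝ≥0, ∀ t, T ≤ t → W t = 0

namespace DHV

/-- Deterministic routing `1 → 2 → 3 → 4 → 5 → 6 → exit`; class `k` has index `k - 1`. -/
def routing : Matrix (Fin 6) (Fin 6) ℝ :=
  Matrix.of fun k l => if k.val + 1 = l.val then 1 else 0

theorem routing_pow_six : routing ^ 6 = 0 := by
  have h : routing = (Int.castRingHom ℝ).mapMatrix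
      (Matrix.of fun k l : Fin 6 => if k.val + 1 = l.val then (1 : ℤ) else 0) := by
    ext k l
    simp [routing, apply_ite]
  have h0 : (Matrix.of fun k l : Fin 6 => if k.val + 1 = l.val then (1 : ℤ) else 0) ^ 6 = 0 := by
    decide
  rw [h, ← map_pow, h0, map_zero]

/-- The Dai-Hasenbein-Vande Vate network: three stations and six classes; jobs arrive at rate
`α₁` to class 1 and go through the classes `1, 2, ..., 6` in order. Station 1 serves classes 1
and 4, station 2 serves classes 2 and 5, and station 3 serves classes 3 and 6. All indices are
shifted down by one. -/
def network (m : Fin 6 → ℝ) (hm : ∀ k, 0 < m k) (α₁ : ℝ) (hα : 0 ≤ α₁) :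
    MulticlassNetwork (Fin 3) (Fin 6) where
  station := ![0, 1, 2, 0, 1, 2]
  m := m
  m_pos := hm
  P := routing
  P_nonneg k l := by
    simp only [routing, Matrix.of_apply]
    split_ifs <;> norm_num
  P_row_sum_le_one k := by
    fin_cases k <;> simp [routing] <;> decide
  summable_pow_P := by
    refine summable_of_ne_finset_zero (s := Finset.range 6) fun n hn => ?_
    rw [Finset.mem_range, not_lt] at hn
    exact pow_eq_zero_of_le hn routing_pow_six
  isUnit_one_sub_transpose_P := by
    refine IsNilpotent.isUnit_one_sub ⟨6, ?_⟩
    rw [← Matrix.transpose_pow, routing_pow_six, Matrix.transpose_zero]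
  α := ![α₁, 0, 0, 0, 0, 0]
  α_nonneg k := by
    fin_cases k <;> simp [hα]

/-- Balance: `m₁ + m₄ = m₂ + m₅ = m₃ + m₆` (indices are shifted down by one). -/
def Balanced (m : Fin 6 → ℝ) : Prop :=
  m 0 + m 3 = m 1 + m 4 ∧ m 1 + m 4 = m 2 + m 5

end DHV

/-! ### Functions that cannot rise while positive. -/

open Matrix

/-! Let `G = C M Q Δ`, and let `V = G W` be the vector of total workloads. By balance every `V_i`
drains at the same rate `γ = 1 - ρ_i`, and it is pushed up only while `W_i = 0`. Suppose that `V_i ≤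
c ⬝ᵥ V` on the face `W_i = 0`, where `c ≥ 0` has sum at most 1. While the bound fails, `V_i` drains
at the full rate and `c ⬝ᵥ V` no faster, so the excess cannot grow; the bound is reached at some
time, since otherwise `V_i` would become negative. Hence it holds from some time on
(`exists_workload_le`), and it may then be used on the next face.

Number the stations 1, 2, 3 and let `x, y, z` be the normalized service times of classes 4, 5, 6.
First `V₁ ≤ x V₃`. If `x < y` and `z ≤ y`, then `V₃ ≤ V₂`, and the two bounds force `V₂ = 0` on `W₂
= 0`. Otherwise `V₂ ≤ c₁ V₁ + c₃ V₃` for suitable weights, and the bounds force `W = 0` on `W₃ = 0`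
(`eq_zero_of_mulVec_le`). The comparison with `c = 0` then makes one workload vanish for good, the
bounds bring down the others, and invertibility of `G` gives `W = 0`. -/

/-- A continuous function on `[0, ∞)` that takes a nonpositive value after time `T₀`, and does not
increase while it is positive after time `T₀`, is eventually nonpositive. -/
theorem exists_forall_ge_nonpos_of_antitone_while_pos {f : ℝ≥0 → ℝ} (hf : Continuous f) {T₀ : ℝ≥0}
    (hanti : ∀ s t, T₀ ≤ s → s ≤ t → (∀ u ∈ Set.Icc s t, 0 < f u) → f t ≤ f s)
    (hex : ∃ T, T₀ ≤ T ∧ f T ≤ 0) : ∃ T, T₀ ≤ T ∧ ∀ t, T ≤ t → f t ≤ 0 := by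
  obtain ⟨T, hT, hfT⟩ := hex
  refine ⟨T, hT, fun t ht => ?_⟩
  by_contra! hpos
  -- Take the last time `s` in `[T, t]` with `f s ≤ 0`. On `(s, t)` the function is positive, so `f
  -- t ≤ f u` there; let `u` decrease to `s`.
  have hcomp : IsCompact (Set.Icc T t ∩ {u | f u ≤ 0}) :=
    isCompact_Icc.inter_right (isClosed_le hf continuous_const)
  obtain ⟨s, ⟨hsI, hs0⟩, hsmax⟩ :=
    hcomp.exists_isGreatest ⟨T, Set.left_mem_Icc.2 ht, hfT⟩
  have hst : s < t := lt_of_le_of_ne hsI.2 fun h => by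
    rw [h] at hs0; exact absurd hs0 (not_le.2 hpos)
  have hle : ∀ u ∈ Set.Ioo s t, f t ≤ f u := fun u hu =>
    hanti u t (hT.trans (hsI.1.trans hu.1.le)) hu.2.le fun v hv => by
      by_contra! hv0
      exact absurd (hsmax ⟨⟨hsI.1.trans (hu.1.le.trans hv.1), hv.2⟩, hv0⟩)
        (not_le.2 (hu.1.trans_le hv.1))
  have hlim : f t ≤ f s := by
    have hmem : s ∈ closure (Set.Ioo s t) := by
      rw [closure_Ioo hst.ne]; exact Set.left_mem_Icc.2 hst.le
    exact closure_minimal hle (isClosed_le continuous_const hf) hmem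
  exact absurd (hlim.trans hs0) (not_le.2 hpos)

/-! ### Comparison of draining workloads. -/

namespace SolvesSkorohod

variable {J : Type*} [Fintype J] {R : Matrix J J ℝ} {θ : J → ℝ} {Y W : ℝ≥0 → J → ℝ}

/-- The pushing process `Y_i` is constant while `W_i` is positive. -/
theorem eq_of_forall_pos (h : SolvesSkorohod R θ Y W) (i : J) {s t : ℝ≥0} (hst : s ≤ t)
    (hpos : ∀ u ∈ Set.Icc s t, 0 < W u i) : Y t i = Y s i := by
  refine le_antisymm ?_ (h.monotone_Y i hst)
  have h0 := h.complementarity i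
  rw [MeasureTheory.lintegral_eq_zero_iff
    (h.continuous_W i).measurable.ennreal_ofReal] at h0
  -- The integrand is nonzero on `(s, t]`, so this interval is null; its Stieltjes measure is the
  -- increment of `Y_i`.
  have hnull := MeasureTheory.measure_mono_null (s := Set.Ioc s t)
    (fun u hu => by simpa using hpos u ⟨hu.1.le, hu.2⟩) (MeasureTheory.ae_iff.1 h0)
  rw [StieltjesFunction.measure_Ioc, ENNReal.ofReal_eq_zero] at hnull
  exact sub_nonpos.1 hnull

variable {G : Matrix J J ℝ} {γ : ℝ}

theorem workload_nonneg (h : SolvesSkorohod R θ Y W) (hG : ∀ i j, 0 ≤ G i j) (t : ℝ≥0) (i : J) :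
    0 ≤ (G *ᵥ W t) i :=
  Finset.sum_nonneg fun k _ => mul_nonneg (hG i k) (h.W_nonneg t k)

/-- The workload `G W` drains at rate `γ` apart from the pushing process. -/
theorem workload_eq [DecidableEq J] (h : SolvesSkorohod R θ Y W) (hGR : G * R = 1)
    (hGθ : G *ᵥ θ = fun _ => -γ) (t : ℝ≥0) (i : J) :
    (G *ᵥ W t) i = (G *ᵥ W 0) i - γ * t + Y t i := by
  rw [h.W_eq t, mulVec_add, mulVec_add, mulVec_smul, hGθ, mulVec_mulVec, hGR, one_mulVec]
  simp only [Pi.add_apply, Pi.smul_apply, smul_eq_mul]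
  ring

/-- If `W_i = 0` forces the workload at `i` below a subconvex combination of the workloads, then
this bound eventually holds at all times. -/
theorem exists_workload_le [DecidableEq J] (h : SolvesSkorohod R θ Y W) (hGR : G * R = 1)
    (hGθ : G *ᵥ θ = fun _ => -γ) (hγ : 0 < γ) (hG : ∀ i j, 0 ≤ G i j) (i : J) {c : J → ℝ}
    (hc : ∀ j, 0 ≤ c j) (hc1 : ∑ j, c j ≤ 1) {T₀ : ℝ≥0}
    (hface : ∀ t, T₀ ≤ t → W t i = 0 → (G *ᵥ W t) i ≤ c ⬝ᵥ (G *ᵥ W t)) :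
    ∃ T, T₀ ≤ T ∧ ∀ t, T ≤ t → (G *ᵥ W t) i ≤ c ⬝ᵥ (G *ᵥ W t) := by
  have hcW : Continuous W := continuous_pi h.continuous_W
  have hdrain : ∀ s t, T₀ ≤ s → s ≤ t →
      (∀ u ∈ Set.Icc s t, 0 < (G *ᵥ W u) i - c ⬝ᵥ (G *ᵥ W u)) →
      (G *ᵥ W t) i = (G *ᵥ W s) i - γ * (t - s) := by
    intro s t hs hst hpos
    have hY := h.eq_of_forall_pos i hst fun u hu =>
      lt_of_le_of_ne (h.W_nonneg u i) fun h0 =>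
        absurd (hface u (hs.trans hu.1) h0.symm) (not_le.2 (sub_pos.1 (hpos u hu)))
    rw [h.workload_eq hGR hGθ t, h.workload_eq hGR hGθ s, hY]
    ring
  have key := exists_forall_ge_nonpos_of_antitone_while_pos
    (f := fun t => (G *ᵥ W t) i - c ⬝ᵥ (G *ᵥ W t)) (T₀ := T₀) ?_ ?_ ?_
  · simpa only [sub_nonpos] using key
  · have hGW : Continuous fun t => G *ᵥ W t := continuous_const.matrix_mulVec hcW
    exact ((continuous_apply i).comp hGW).sub (continuous_const.dotProduct hGW)
  · intro s t hs hst hpos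
    -- No workload falls faster than `γ`, so a subconvex combination does not either.
    have hlow : c ⬝ᵥ (G *ᵥ W s) - γ * (t - s) ≤ c ⬝ᵥ (G *ᵥ W t) := by
      have hst' : (0 : ℝ) ≤ t - s := sub_nonneg.2 (NNReal.coe_le_coe.2 hst)
      calc c ⬝ᵥ (G *ᵥ W s) - γ * (t - s)
          ≤ c ⬝ᵥ (G *ᵥ W s) - (∑ j, c j) * (γ * (t - s)) :=
            sub_le_sub_left (mul_le_of_le_one_left (mul_nonneg hγ.le hst') hc1) _
        _ = ∑ j, c j * ((G *ᵥ W s) j - γ * (t - s)) := by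
            simp only [mul_sub, Finset.sum_sub_distrib, dotProduct, Finset.sum_mul]
        _ ≤ c ⬝ᵥ (G *ᵥ W t) := by
            refine Finset.sum_le_sum fun j _ => mul_le_mul_of_nonneg_left ?_ (hc j)
            rw [h.workload_eq hGR hGθ t, h.workload_eq hGR hGθ s]
            have := h.monotone_Y j hst
            simp only at this
            linarith
    have := hdrain s t hs hst hpos
    linarith
  -- If the bound failed forever, `V_i` would fall linearly and be negative by time `T₀ + n`.
  · by_contra! hall
    obtain ⟨n, hn⟩ := exists_nat_gt ((G *ᵥ W T₀) i / γ)
    have hd := hdrain T₀ (T₀ + n) le_rfl le_self_add fun u hu => hall u hu.1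
    rw [div_lt_iff₀ hγ] at hn
    have := h.workload_nonneg hG (T₀ + n) i
    push_cast at hd
    linarith

end SolvesSkorohod
-- The normalized workload matrix.
namespace DHV

/-- The matrix `C M Q Δ` of a balanced network whose common sum of service times is `1`:
`x`, `y`, `z` are the mean service times of the classes 4, 5, 6 and `a k` is the nonzero entry of
the ratio matrix for class `k`. -/
def workloadMatrix (x y z : ℝ) (a : Fin 6 → ℝ) : Matrix (Fin 3) (Fin 3) ℝ :=
  !![a 0 + x * a 3, x * a 1, x * a 2;
     a 0 + y * a 3, a 1 + y * a 4, y * a 2;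
     a 0 + z * a 3, a 1 + z * a 4, a 2 + z * a 5]

variable {x y z : ℝ} {a : Fin 6 → ℝ}

theorem det_workloadMatrix (h0 : (1 - x) * a 0 + x * a 3 = 1) (h1 : (1 - y) * a 1 + y * a 4 = 1)
    (h2 : (1 - z) * a 2 + z * a 5 = 1) :
    (workloadMatrix x y z a).det = 1 + (1 - x) * (1 - y) * z * (a 0 * a 1 * a 2)
      + (1 - x) * y * z * (a 0 * a 1 * a 5) + x * z * (1 - y) * (a 0 * a 2 * a 4)
      + x * y * z * (a 0 * a 4 * a 5) := by
  have h : (1 : ℝ) = ((1 - x) * a 0 + x * a 3) * ((1 - y) * a 1 + y * a 4)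
      * ((1 - z) * a 2 + z * a 5) := by rw [h0, h1, h2]; norm_num
  rw [show (1 : ℝ) + (1 - x) * (1 - y) * z * (a 0 * a 1 * a 2)
      + (1 - x) * y * z * (a 0 * a 1 * a 5) + x * z * (1 - y) * (a 0 * a 2 * a 4)
      + x * y * z * (a 0 * a 4 * a 5) = ((1 - x) * a 0 + x * a 3) * ((1 - y) * a 1 + y * a 4)
      * ((1 - z) * a 2 + z * a 5) + (1 - x) * (1 - y) * z * (a 0 * a 1 * a 2)
      + (1 - x) * y * z * (a 0 * a 1 * a 5) + x * z * (1 - y) * (a 0 * a 2 * a 4)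
      + x * y * z * (a 0 * a 4 * a 5) by rw [← h]]
  simp [workloadMatrix, det_fin_three]
  ring

theorem isUnit_workloadMatrix (hx : 0 < x) (hx1 : x < 1) (hy : 0 < y) (hy1 : y < 1) (hz : 0 < z)
    (ha : ∀ k, 0 ≤ a k) (h0 : (1 - x) * a 0 + x * a 3 = 1)
    (h1 : (1 - y) * a 1 + y * a 4 = 1) (h2 : (1 - z) * a 2 + z * a 5 = 1) :
    IsUnit (workloadMatrix x y z a) := by
  rw [isUnit_iff_isUnit_det, isUnit_iff_ne_zero, det_workloadMatrix h0 h1 h2]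
  have := sub_pos.2 hx1
  have := sub_pos.2 hy1
  have := ha 0
  have := ha 1
  have := ha 2
  have := ha 4
  have := ha 5
  positivity

theorem workloadMatrix_mulVec (x y z : ℝ) (a : Fin 6 → ℝ) (w : Fin 3 → ℝ) :
    workloadMatrix x y z a *ᵥ w =
      ![(a 0 + x * a 3) * w 0 + x * a 1 * w 1 + x * a 2 * w 2,
        (a 0 + y * a 3) * w 0 + (a 1 + y * a 4) * w 1 + y * a 2 * w 2,
        (a 0 + z * a 3) * w 0 + (a 1 + z * a 4) * w 1 + (a 2 + z * a 5) * w 2] := by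
  ext i
  fin_cases i <;> simp [workloadMatrix, mulVec, dotProduct, Fin.sum_univ_three]

theorem workloadMatrix_nonneg (hx : 0 ≤ x) (hy : 0 ≤ y) (hz : 0 ≤ z) (ha : ∀ k, 0 ≤ a k)
    (i j : Fin 3) : 0 ≤ workloadMatrix x y z a i j := by
  have := ha 0
  have := ha 1
  have := ha 2
  have := ha 3
  have := ha 4
  have := ha 5
  fin_cases i <;> fin_cases j <;> simp [workloadMatrix] <;> positivity

/-- A ratio-matrix column gives positive weight to any positive combination of its classes. -/
theorem add_mul_pos_of_weighted_eq_one {p b d u : ℝ} (hb : 0 ≤ b) (hd : 0 ≤ d) (hu : 0 < u)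
    (h : (1 - p) * b + p * d = 1) : 0 < b + u * d := by
  rcases hb.eq_or_lt with rfl | hb
  · rcases hd.eq_or_lt with rfl | hd
    · simp at h
    · positivity
  · positivity

/-- If the workloads satisfy `V₁ ≤ x V₃` and `V₂ ≤ c₁ V₁ + c₃ V₃`, where the latter bound is
tight on the first axis and fails on the second one, then `W₃ = 0` implies `W = 0`. -/
theorem eq_zero_of_mulVec_le (hx : 0 < x) (hx1 : x < 1) (hz1 : z < 1)
    (ha : ∀ k, 0 ≤ a k) (h0 : (1 - x) * a 0 + x * a 3 = 1)
    {c₁ c₃ : ℝ}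
    (haxis : a 0 + y * a 3 = c₁ * (a 0 + x * a 3) + c₃ * (a 0 + z * a 3))
    (haxis' : c₁ * (x * a 1) + c₃ * (a 1 + z * a 4) < a 1 + y * a 4)
    {w : Fin 3 → ℝ} (hw : ∀ j, 0 ≤ w j) (hw2 : w 2 = 0)
    (hV0 : (workloadMatrix x y z a *ᵥ w) 0 ≤ x * (workloadMatrix x y z a *ᵥ w) 2)
    (hV1 : (workloadMatrix x y z a *ᵥ w) 1 ≤
      c₁ * (workloadMatrix x y z a *ᵥ w) 0 + c₃ * (workloadMatrix x y z a *ᵥ w) 2) :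
    w = 0 := by
  simp only [workloadMatrix_mulVec, hw2, mul_zero, add_zero, cons_val_zero, cons_val_one,
    cons_val] at hV0 hV1
  have hw1 : w 1 = 0 := by
    by_contra hne
    have hpos : 0 < w 1 := lt_of_le_of_ne (hw 1) (Ne.symm hne)
    -- Tightness on the first axis cancels the `w 0` terms of `hV1`, leaving an inequality in `w 1`
    -- alone that contradicts strictness.
    have e : (a 0 + y * a 3) * w 0 = (c₁ * (a 0 + x * a 3) + c₃ * (a 0 + z * a 3)) * w 0 := by
      rw [haxis]
    have := mul_lt_mul_of_pos_right haxis' hpos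
    linarith
  have hw0 : w 0 = 0 := by
    by_contra hne
    have hpos : 0 < w 0 := lt_of_le_of_ne (hw 0) (Ne.symm hne)
    rw [hw1] at hV0
    have hgap : 0 < (1 - x) * a 0 + (x * (1 - z)) * a 3 := by
      have hx1' := sub_pos.2 hx1
      have hz1' := sub_pos.2 hz1
      rcases (ha 0).eq_or_lt with h | h
      · rcases (ha 3).eq_or_lt with h' | h'
        · rw [← h, ← h'] at h0; simp at h0
        · rw [← h]; positivity
      · have := ha 3
        positivity
    have := mul_pos hgap hpos
    linarith
  ext j
  fin_cases j <;> simp [hw0, hw1, hw2]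

/-! ### Stability of the normalized problem. -/

/-- The Skorohod problem of a balanced network with common sum of service times `1` is stable. -/
theorem skorohodStable_of_workloadMatrix (hx : 0 < x) (hx1 : x < 1) (hy : 0 < y) (hy1 : y < 1)
    (hz : 0 < z) (hz1 : z < 1) (ha : ∀ k, 0 ≤ a k) (h0 : (1 - x) * a 0 + x * a 3 = 1)
    (h1 : (1 - y) * a 1 + y * a 4 = 1) (h2 : (1 - z) * a 2 + z * a 5 = 1)
    {R : Matrix (Fin 3) (Fin 3) ℝ} {θ : Fin 3 → ℝ} {γ : ℝ} (hγ : 0 < γ)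
    (hGR : workloadMatrix x y z a * R = 1) (hGθ : workloadMatrix x y z a *ᵥ θ = fun _ => -γ) :
    SkorohodStable R θ := by
  intro Y W h
  have hG := workloadMatrix_nonneg hx.le hy.le hz.le ha
  have hmul := workloadMatrix_mulVec x y z a
  have ha0 := ha 0
  have ha1 := ha 1
  have ha2 := ha 2
  have ha3 := ha 3
  have ha4 := ha 4
  have ha5 := ha 5
  have hVnonneg := h.workload_nonneg hG
  have hzero : ∀ w : Fin 3 → ℝ, workloadMatrix x y z a *ᵥ w = 0 → w = 0 := fun w hw =>
    mulVec_injective_of_isUnit (isUnit_workloadMatrix hx hx1 hy hy1 hz ha h0 h1 h2)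
      (hw.trans (mulVec_zero _).symm)
  obtain ⟨T₁, -, hT₁⟩ := h.exists_workload_le hGR hGθ hγ hG 0 (c := ![0, 0, x]) (T₀ := 0)
    (fun j => by fin_cases j <;> simp [hx.le]) (by simpa [Fin.sum_univ_three] using hx1.le)
    (fun t _ hW => by
      have := h.W_nonneg t 1
      have := h.W_nonneg t 2
      have e : 0 ≤ x * z * (a 4 * W t 1 + a 5 * W t 2) := by positivity
      simp only [hmul, dotProduct, Fin.sum_univ_three, cons_val_zero, cons_val_one, cons_val, hW]
      linarith)
  simp only [dotProduct, Fin.sum_univ_three, cons_val_zero, cons_val_one, cons_val, zero_mul,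
    zero_add] at hT₁
  -- The complementary case is `y ≤ x` or `x < y < z`; there `V₂` can be bounded by the other two
  -- workloads.
  by_cases hcase : x < y ∧ z ≤ y
  · obtain ⟨hxy, hzy⟩ := hcase
    obtain ⟨T₂, hT₁₂, hT₂⟩ := h.exists_workload_le hGR hGθ hγ hG 2 (c := ![0, 1, 0]) (T₀ := T₁)
      (fun j => by fin_cases j <;> simp) (by simp [Fin.sum_univ_three])
      (fun t _ hW => by
        have := h.W_nonneg t 0
        have := h.W_nonneg t 1
        have := sub_nonneg.2 hzy
        have e : 0 ≤ (y - z) * (a 3 * W t 0 + a 4 * W t 1) := by positivity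
        simp only [hmul, dotProduct, Fin.sum_univ_three, cons_val_zero, cons_val_one, cons_val, hW]
        linarith)
    simp only [dotProduct, Fin.sum_univ_three, cons_val_zero, cons_val_one, cons_val, zero_mul,
      zero_add, one_mul, add_zero] at hT₂
    obtain ⟨T₃, hT₂₃, hT₃⟩ := h.exists_workload_le hGR hGθ hγ hG 1 (c := 0) (T₀ := T₂)
      (fun j => by simp) (by simp)
      (fun t ht hW => by
        have b1 := hT₁ t (hT₁₂.trans ht)
        have b2 := mul_le_mul_of_nonneg_left (hT₂ t ht) hx.le
        have b := b1.trans b2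
        have hw0 := h.W_nonneg t 0
        have hw2 := h.W_nonneg t 2
        simp only [hmul, cons_val_zero, cons_val_one, hW] at b
        simp only [hmul, zero_dotProduct, cons_val_one, hW]
        have hx1' := sub_pos.2 hx1
        have hy1' := sub_pos.2 hy1
        have e1 : 0 ≤ a 0 * W t 0 := by positivity
        have e2 : 0 ≤ a 3 * W t 0 := by positivity
        have e3 : 0 ≤ a 2 * W t 2 := by positivity
        have f1 : 0 ≤ (1 - x) * (a 0 * W t 0) := by positivity
        have f2 : 0 ≤ x * (1 - y) * (a 3 * W t 0) := by positivity
        have f3 : 0 ≤ x * (1 - y) * (a 2 * W t 2) := by positivity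
        -- With `W₂ = 0`, the bound `V₁ ≤ x V₂` says that `f1`, `f2`, `f3` concern three nonnegative
        -- terms with sum at most 0, so each term vanishes.
        have g1 : (1 - x) * (a 0 * W t 0) = 0 := by linarith
        have g2 : x * (1 - y) * (a 3 * W t 0) = 0 := by linarith
        have g3 : x * (1 - y) * (a 2 * W t 2) = 0 := by linarith
        have k1 : a 0 * W t 0 = 0 := (mul_eq_zero_iff_left hx1'.ne').1 g1
        have k2 : a 3 * W t 0 = 0 := (mul_eq_zero_iff_left (by positivity)).1 g2
        have k3 : a 2 * W t 2 = 0 := (mul_eq_zero_iff_left (by positivity)).1 g3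
        have : (a 0 + y * a 3) * W t 0 + (a 1 + y * a 4) * 0 + y * a 2 * W t 2 = 0 := by
          linear_combination k1 + y * k2 + y * k3
        exact this.le)
    refine ⟨T₃, fun t ht => hzero _ ?_⟩
    have v1 := hT₃ t ht
    rw [zero_dotProduct] at v1
    have v2 := (hT₂ t (hT₂₃.trans ht)).trans v1
    have v0 := hT₁ t (hT₁₂.trans (hT₂₃.trans ht))
    have v0' := v0.trans (mul_nonpos_of_nonneg_of_nonpos hx.le v2)
    ext i
    refine le_antisymm ?_ (hVnonneg t i)
    fin_cases i
    exacts [v0', v1, v2]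
  · obtain ⟨c₁, c₃, hc₁, hc₃, hc, haxis, haxis', hface⟩ : ∃ c₁ c₃ : ℝ, 0 ≤ c₁ ∧ 0 ≤ c₃ ∧
        c₁ + c₃ ≤ 1 ∧ a 0 + y * a 3 = c₁ * (a 0 + x * a 3) + c₃ * (a 0 + z * a 3) ∧
        c₁ * (x * a 1) + c₃ * (a 1 + z * a 4) < a 1 + y * a 4 ∧
        y * a 2 ≤ c₁ * (x * a 2) + c₃ * (a 2 + z * a 5) := by
      have p0x := add_mul_pos_of_weighted_eq_one ha0 ha3 hx h0
      have p1y := add_mul_pos_of_weighted_eq_one ha1 ha4 hy h1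
      by_cases hyx : y ≤ x
      · have hr1 : (a 0 + y * a 3) / (a 0 + x * a 3) ≤ 1 := by
          rw [div_le_one p0x]; gcongr
        -- With `c₃ = 0`, tightness on the first axis dictates `c₁`; it is at most 1 because `y ≤
        -- x`.
        refine ⟨(a 0 + y * a 3) / (a 0 + x * a 3), 0, by positivity, le_rfl, by simpa using hr1,
          by rw [zero_mul, add_zero, div_mul_cancel₀ _ p0x.ne'], ?_, ?_⟩
        · rw [zero_mul, add_zero]
          have b : (a 0 + y * a 3) / (a 0 + x * a 3) * (x * a 1) ≤ x * a 1 :=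
            mul_le_of_le_one_left (by positivity) hr1
          rcases ha1.eq_or_lt with hh | hh
          · rw [← hh] at p1y ⊢
            simpa using p1y
          · have : x * a 1 < a 1 := mul_lt_of_lt_one_left hh hx1
            have : 0 ≤ y * a 4 := by positivity
            linarith
        · rw [zero_mul, add_zero]
          have : y * (a 0 + x * a 3) ≤ x * (a 0 + y * a 3) := by
            have := mul_le_mul_of_nonneg_right hyx ha0
            linarith
          have hr : y ≤ (a 0 + y * a 3) / (a 0 + x * a 3) * x := by
            rw [div_mul_eq_mul_div, le_div_iff₀ p0x]; linarith
          have := mul_le_mul_of_nonneg_right hr ha2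
          linarith
      · push Not at hyx hcase
        have hyz := hcase hyx
        have d : 0 < z - x := sub_pos.2 (hyx.trans hyz)
        have d1 := sub_pos.2 hyx
        have d2 := sub_pos.2 hyz
        -- Here `y` lies between `x` and `z`; the weights are its barycentric coordinates, and
        -- tightness on the first axis follows by linearity in `y`.
        have hsum : (z - y) / (z - x) + (y - x) / (z - x) = 1 := by field_simp; ring
        have hbar : (z - y) / (z - x) * x + (y - x) / (z - x) * z = y := by field_simp; ring
        have l1 : 0 < (z - y) / (z - x) := by positivity
        have l2 : 0 < (y - x) / (z - x) := by positivity
        set p := (z - y) / (z - x)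
        set q := (y - x) / (z - x)
        refine ⟨p, q, l1.le, l2.le, hsum.le, ?_, ?_, ?_⟩
        · linear_combination (-a 0) * hsum - a 3 * hbar
        · have e1 : p * (x * a 1) + q * (a 1 + z * a 4)
              = a 1 + y * a 4 - p * ((1 - x) * a 1 + x * a 4) := by
            linear_combination a 1 * hsum + a 4 * hbar
          have : 0 < (1 - x) * a 1 + x * a 4 := by
            have hx1' := sub_pos.2 hx1
            rcases ha1.eq_or_lt with hh | hh
            · rw [← hh] at p1y ⊢
              have : 0 < a 4 := by
                rw [zero_add] at p1y
                exact (pos_iff_pos_of_mul_pos p1y).1 hy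
              positivity
            · positivity
          have := mul_pos l1 this
          linarith
        · have e1 : p * (x * a 2) + q * (a 2 + z * a 5)
              = y * a 2 + q := by
            linear_combination a 2 * hbar + q * h2
          linarith
    obtain ⟨T₂, hT₁₂, hT₂⟩ := h.exists_workload_le hGR hGθ hγ hG 1 (c := ![c₁, 0, c₃]) (T₀ := T₁)
      (fun j => by fin_cases j <;> simp [hc₁, hc₃]) (by simpa [Fin.sum_univ_three] using hc)
      (fun t _ hW => by
        have e2 := mul_le_mul_of_nonneg_right hface (h.W_nonneg t 2)
        simp only [hmul, dotProduct, Fin.sum_univ_three, cons_val_zero, cons_val_one, cons_val, hW]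
        rw [haxis]
        linarith)
    simp only [dotProduct, Fin.sum_univ_three, cons_val_zero, cons_val_one, cons_val, zero_mul,
      add_zero] at hT₂
    obtain ⟨T₃, hT₂₃, hT₃⟩ := h.exists_workload_le hGR hGθ hγ hG 2 (c := 0) (T₀ := T₂)
      (fun j => by simp) (by simp)
      (fun t ht hW => by
        have := eq_zero_of_mulVec_le hx hx1 hz1 ha h0 haxis haxis' (h.W_nonneg t) hW
          (hT₁ t (hT₁₂.trans ht)) (hT₂ t ht)
        simp [this])
    refine ⟨T₃, fun t ht => hzero _ ?_⟩
    have v2 := hT₃ t ht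
    rw [zero_dotProduct] at v2
    have v0 := (hT₁ t (hT₁₂.trans (hT₂₃.trans ht))).trans
      (mul_nonpos_of_nonneg_of_nonpos hx.le v2)
    have v1 := (hT₂ t (hT₂₃.trans ht)).trans (add_nonpos
      (mul_nonpos_of_nonneg_of_nonpos hc₁ v0) (mul_nonpos_of_nonneg_of_nonpos hc₃ v2))
    ext i
    refine le_antisymm ?_ (hVnonneg t i)
    fin_cases i
    exacts [v0, v1, v2]

/-! ### Reduction of the network to normalized form. -/

/-- `Q k l = 1` exactly when class `k` is visited from class `l` on. -/
theorem network_Q (m : Fin 6 → ℝ) (hm : ∀ k, 0 < m k) (α₁ : ℝ) (hα : 0 ≤ α₁) :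
    (network m hm α₁ hα).Q = of fun k l => if l ≤ k then 1 else 0 := by
  refine inv_eq_left_inv ?_
  -- Over `ℤ` the inverse relation is decidable; it is then transported to `ℝ`.
  have h : (of fun k l : Fin 6 => if l ≤ k then (1 : ℤ) else 0) *
      (1 - (of fun k l : Fin 6 => if k.val + 1 = l.val then (1 : ℤ) else 0)ᵀ) = 1 := by
    decide
  have h' := congrArg (Int.castRingHom ℝ).mapMatrix h
  rw [map_mul, map_sub, map_one] at h'
  have hQ : (Int.castRingHom ℝ).mapMatrix (of fun k l : Fin 6 => if l ≤ k then (1 : ℤ) else 0) =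
      of fun k l => if l ≤ k then 1 else 0 := by
    ext k l; simp [apply_ite]
  have hP : (Int.castRingHom ℝ).mapMatrix
      (of fun k l : Fin 6 => if k.val + 1 = l.val then (1 : ℤ) else 0)ᵀ =
      (network m hm α₁ hα).Pᵀ := by
    ext k l; simp [network, routing, apply_ite]
  rwa [hQ, hP] at h'

theorem network_CMQ (m : Fin 6 → ℝ) (hm : ∀ k, 0 < m k) (α₁ : ℝ) (hα : 0 ≤ α₁) :
    (network m hm α₁ hα).C * (network m hm α₁ hα).M * (network m hm α₁ hα).Q =
      !![m 0 + m 3, m 3, m 3, m 3, 0, 0;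
         m 1 + m 4, m 1 + m 4, m 4, m 4, m 4, 0;
         m 2 + m 5, m 2 + m 5, m 2 + m 5, m 5, m 5, m 5] := by
  rw [network_Q]
  ext i k
  simp only [mul_apply, MulticlassNetwork.C, MulticlassNetwork.M, network, of_apply,
    Fin.sum_univ_six]
  fin_cases i <;> fin_cases k <;> simp [Fin.le_def]

theorem network_ρ (m : Fin 6 → ℝ) (hm : ∀ k, 0 < m k) (α₁ : ℝ) (hα : 0 ≤ α₁) :
    (network m hm α₁ hα).ρ =
      ![(m 0 + m 3) * α₁, (m 1 + m 4) * α₁, (m 2 + m 5) * α₁] := by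
  rw [MulticlassNetwork.ρ, MulticlassNetwork.effectiveRate, mulVec_mulVec, network_CMQ]
  ext i
  fin_cases i <;> simp [network, mulVec, dotProduct, Fin.sum_univ_six]

section RatioMatrix

variable {m : Fin 6 → ℝ} {hm : ∀ k, 0 < m k} {α₁ : ℝ} {hα : 0 ≤ α₁} {Δ : Matrix (Fin 6) (Fin 3) ℝ}

theorem ratioMatrix_weights (hΔ : (network m hm α₁ hα).IsRatioMatrix Δ) :
    m 0 * Δ 0 0 + m 3 * Δ 3 0 = 1 ∧ m 1 * Δ 1 1 + m 4 * Δ 4 1 = 1 ∧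
      m 2 * Δ 2 2 + m 5 * Δ 5 2 = 1 := by
  have h := fun i => congrFun (congrFun hΔ.workload i) i
  simp only [mul_apply, MulticlassNetwork.C, MulticlassNetwork.M, network, of_apply,
    Fin.sum_univ_six] at h
  refine ⟨by simpa using h 0, by simpa using h 1, by simpa using h 2⟩

/-- Dividing service times by their common sum and multiplying the ratio matrix by it leaves `C M Q
Δ` unchanged, so the sum may be taken to be 1. -/
theorem invReflection_eq_workloadMatrix (hbalanced : Balanced m)
    (hΔ : (network m hm α₁ hα).IsRatioMatrix Δ) :
    (network m hm α₁ hα).invReflection Δ =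
      workloadMatrix (m 3 / (m 0 + m 3)) (m 4 / (m 0 + m 3)) (m 5 / (m 0 + m 3))
        fun k => (m 0 + m 3) * Δ k ((network m hm α₁ hα).station k) := by
  have hs : m 0 + m 3 ≠ 0 := (add_pos (hm 0) (hm 3)).ne'
  obtain ⟨b1, b2⟩ := hbalanced
  have hz : ∀ k j, (![0, 1, 2, 0, 1, 2] : Fin 6 → Fin 3) k ≠ j → Δ k j = 0 :=
    hΔ.eq_zero_of_station_ne
  rw [MulticlassNetwork.invReflection, network_CMQ, ← b2, ← b1]
  ext i j
  simp only [mul_apply, Fin.sum_univ_six, network, workloadMatrix]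
  fin_cases j
  · rw [hz 1 _ (by decide), hz 2 _ (by decide), hz 4 _ (by decide), hz 5 _ (by decide)]
    fin_cases i <;> simp <;> field_simp
  · rw [hz 0 _ (by decide), hz 2 _ (by decide), hz 3 _ (by decide), hz 5 _ (by decide)]
    fin_cases i <;> simp <;> field_simp
  · rw [hz 0 _ (by decide), hz 1 _ (by decide), hz 3 _ (by decide), hz 4 _ (by decide)]
    fin_cases i <;> simp <;> field_simp

end RatioMatrix

end DHV

theorem mainTheorem9 (m : Fin 6 → ℝ) (hm : ∀ k, 0 < m k) (α₁ : ℝ) (hα : 0 ≤ α₁)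
    (hbalanced : DHV.Balanced m)
    (hload : (DHV.network m hm α₁ hα).NominalLoad)
    (Δ : Matrix (Fin 6) (Fin 3) ℝ) (hΔ : (DHV.network m hm α₁ hα).IsRatioMatrix Δ) :
    IsUnit ((DHV.network m hm α₁ hα).invReflection Δ) ∧
      SkorohodStable ((DHV.network m hm α₁ hα).R Δ) ((DHV.network m hm α₁ hα).θ Δ) := by
  have hG := DHV.invReflection_eq_workloadMatrix hbalanced hΔ
  obtain ⟨e0, e1, e2⟩ := DHV.ratioMatrix_weights hΔ
  have hs : 0 < m 0 + m 3 := add_pos (hm 0) (hm 3)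
  have hm1 := hm 1
  have hm2 := hm 2
  have hm0 := hm 0
  have hx : 0 < m 3 / (m 0 + m 3) := div_pos (hm 3) hs
  have hy : 0 < m 4 / (m 0 + m 3) := div_pos (hm 4) hs
  have hz : 0 < m 5 / (m 0 + m 3) := div_pos (hm 5) hs
  have hbal := hbalanced
  obtain ⟨b1, b2⟩ := hbal
  have hx1 : m 3 / (m 0 + m 3) < 1 := by rw [div_lt_one hs]; linarith
  have hy1 : m 4 / (m 0 + m 3) < 1 := by rw [div_lt_one hs]; linarith
  have hz1 : m 5 / (m 0 + m 3) < 1 := by rw [div_lt_one hs]; linarith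
  have ha : ∀ k, 0 ≤ (m 0 + m 3) * Δ k ((DHV.network m hm α₁ hα).station k) := fun k =>
    mul_nonneg hs.le (hΔ.nonneg k _)
  have h0 : (1 - m 3 / (m 0 + m 3)) * ((m 0 + m 3) * Δ 0 0)
      + m 3 / (m 0 + m 3) * ((m 0 + m 3) * Δ 3 0) = 1 := by
    field_simp; linear_combination e0
  have h1 : (1 - m 4 / (m 0 + m 3)) * ((m 0 + m 3) * Δ 1 1)
      + m 4 / (m 0 + m 3) * ((m 0 + m 3) * Δ 4 1) = 1 := by
    field_simp; linear_combination e1 + Δ 1 1 * b1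
  have h2 : (1 - m 5 / (m 0 + m 3)) * ((m 0 + m 3) * Δ 2 2)
      + m 5 / (m 0 + m 3) * ((m 0 + m 3) * Δ 5 2) = 1 := by
    field_simp; linear_combination e2 + Δ 2 2 * (b1 + b2)
  have hunit : IsUnit ((DHV.network m hm α₁ hα).invReflection Δ) :=
    hG ▸ DHV.isUnit_workloadMatrix hx hx1 hy hy1 hz ha h0 h1 h2
  have hGR : (DHV.network m hm α₁ hα).invReflection Δ * (DHV.network m hm α₁ hα).R Δ = 1 :=
    mul_nonsing_inv _ ((isUnit_iff_isUnit_det _).1 hunit)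
  refine ⟨hunit, ?_⟩
  have hγ : 0 < 1 - (m 0 + m 3) * α₁ := by
    have := hload 0
    rw [DHV.network_ρ] at this
    exact sub_pos.2 this
  refine DHV.skorohodStable_of_workloadMatrix hx hx1 hy hy1 hz hz1 ha h0 h1 h2 hγ
    (hG ▸ hGR) ?_
  -- Since `G R = 1`, the workload drift `G θ` is `ρ - e`, whose entries coincide by balance.
  rw [← hG, MulticlassNetwork.θ, mulVec_mulVec, hGR, one_mulVec, DHV.network_ρ, ← b2, ← b1]
  ext i
  fin_cases i <;> simp
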